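/- All graphs are finite and simple. $K_n$ is the complete graph on $n\ge 1$ vertices, $K_{1,3}$ is the claw and $P_4$ is the path on four vertices; $A\sqcup B$ denotes the vertex-disjoint union of two graphs, and $A+B$ their join (the disjoint union together with all edges between $V(A)$ and $V(B)$). A graph is $4$-connected if it has more than $4$ vertices and remains connected whenever fewer than $4$ vertices are deleted, and it is $\{K_{1,3},P_4\}$-free if it has no induced subgraph isomorphic to $K_{1,3}$ or to $P_4$. The square of a graph is obtained by adding an edge between every pair of vertices at distance two. A graph $G$ has an $H^2$ (a hamiltonian square) if it has a hamiltonian cycle $C$ such that the square of $C$ is a subgraph of $G$. **Theorem.** Every $4$-connected $\{K_{1,3},P_4\}$-free graph $G$ has an $H^2$ unless $G$ is isomorphic to a graph in one of the following families: (i) $(K_1\sqcup K_3)+(K_m\sqcup K_q)$ with $m,q\ge 1$ and $m+q\ge 4$; (ii) $(K_2\sqcup K_2)+(K_1\sqcup K_m)$ with $m\ge 3$; (iii) $(K_2\sqcup K_3)+(K_1\sqcup K_m)$ with $m\ge 3$; (iv) $(K_3\sqcup K_3)+(K_1\sqcup K_m)$ with $m\ge 3$. -/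

import Mathlib

namespace SimpleGraph

/-- `G` is `k`-connected: it has more than `k` vertices, and deleting fewer than `k` vertices
always leaves a connected graph. -/
def IsVertexKConnected {V : Type*} [Fintype V] (G : SimpleGraph V) (k : ℕ) : Prop :=
  k < Fintype.card V ∧
    ∀ S : Finset V, S.card < k → (G.induce ((S : Set V)ᶜ)).Connected

/-- The square of a graph: join additionally all pairs of vertices at distance two. -/
def distSquare {V : Type*} (G : SimpleGraph V) : SimpleGraph V where
  Adj u v := G.Adj u v ∨ G.dist u v = 2
  symm := ⟨fun u v h => by rwa [G.adj_comm, G.dist_comm]⟩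
  loopless := ⟨fun u h => by simp at h⟩

/-- `G` contains a hamiltonian square: some hamiltonian cycle `p` of `G`, seen as a graph on the
vertices of `G` whose edges are only those of the cycle, has its square contained in `G`. -/
def HasHamiltonianSquare {V : Type*} [DecidableEq V] (G : SimpleGraph V) : Prop :=
  ∃ (a : V) (p : G.Walk a a), p.IsHamiltonianCycle ∧ p.toSubgraph.spanningCoe.distSquare ≤ G

/-- The join of two vertex-disjoint graphs: their disjoint union together with all the edges
between the two sides. -/
def disjointJoin {V W : Type*} (G : SimpleGraph V) (H : SimpleGraph W) : SimpleGraph (V ⊕ W) :=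
  (G ⊕g H) ⊔ completeBipartiteGraph V W

/-- The graph `(K_a ⊔ K_b) + (K_c ⊔ K_d)`, where `⊔` is disjoint union and `+` is the join. -/
def joinOfCompletePairs (a b c d : ℕ) :
    SimpleGraph ((Fin a ⊕ Fin b) ⊕ (Fin c ⊕ Fin d)) :=
  (completeGraph (Fin a) ⊕g completeGraph (Fin b)).disjointJoin
    (completeGraph (Fin c) ⊕g completeGraph (Fin d))

end SimpleGraph

/-! ### Hamiltonian squares as cyclic orders of the vertices. -/

namespace SimpleGraph

/-! A hamiltonian square is a cyclic order in which nonadjacent vertices are at cyclic distance at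
least three. Such orders are built by cutting the vertex set into consecutive blocks
(`hasHamiltonianSquare_of_label`).

The complement `Gᶜ` controls where nonadjacent vertices may go. Connectedness and the two forbidden
subgraphs make each nontrivial component of `Gᶜ` complete bipartite (`complTwin_of_free`), so `G` is
a join of pairs `K_a ⊔ K_b` and single vertices. By 4-connectivity at least four vertices lie
outside any such component (`IsVertexKConnected.le_ncard`). A component is handled through an edge
`u v` of `Gᶜ`; its sides are the `Gᶜ`-neighbourhoods of `u` and `v`, that of `u` being the side
containing `v`.

If at most one component is nontrivial, or if two of them leave a vertex uncovered, a suitable block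
order exists. If two components span `G`, an order exists when all four sides have two vertices, or
when each component has a side with four. The remaining size patterns are exactly the exceptional
families. -/

theorem cycleGraph_adj_of_lt {n : ℕ} {i j : Fin n} (hij : i < j) (h : (cycleGraph n).Adj i j) :
    j.val = i.val + 1 ∨ j.val + 1 = i.val + n := by
  have hi := i.isLt
  have hj := j.isLt
  have hlt : i.val < j.val := hij
  rw [cycleGraph_adj'] at h
  rcases h with h | h
  · rw [Fin.coe_sub_iff_lt.2 hij] at h
    omega
  · rw [Fin.sub_val_of_le hij.le] at h
    omega

/-- The hypothesis says that a nonadjacent pair is at least three steps apart in both directions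
around the cycle, so all pairs at cyclic distance one or two are edges. -/
theorem hasHamiltonianSquare_of_equiv {V : Type*} [Fintype V] [DecidableEq V]
    (G : SimpleGraph V) {n : ℕ} (hn : 5 ≤ n) (e : Fin n ≃ V)
    (h : ∀ i j : Fin n, i < j → ¬ G.Adj (e i) (e j) →
      i.val + 3 ≤ j.val ∧ j.val + 3 ≤ i.val + n) :
    G.HasHamiltonianSquare := by
  have hne : ∀ i j : Fin n, (cycleGraph n).Adj i j → i.val + 1 = j.val ∨ j.val + 1 = i.val ∨
      i.val + 1 = j.val + n ∨ j.val + 1 = i.val + n := by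
    intro i j hij
    rcases lt_or_gt_of_ne hij.ne with hlt | hlt
    · have := cycleGraph_adj_of_lt hlt hij
      omega
    · have := cycleGraph_adj_of_lt hlt hij.symm
      omega
  have hadj : ∀ i j : Fin n, i ≠ j →
      (i.val < j.val → j.val < i.val + 3 ∨ i.val + n < j.val + 3) →
      (j.val < i.val → i.val < j.val + 3 ∨ j.val + n < i.val + 3) → G.Adj (e i) (e j) := by
    intro i j hij h1 h2
    by_contra hna
    rcases lt_or_gt_of_ne hij with hlt | hlt
    · have := h i j hlt hna
      have := h1 hlt
      omega
    · have := h j i hlt (fun h => hna h.symm)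
      have := h2 hlt
      omega
  obtain ⟨k, rfl⟩ : ∃ k, n = k + 3 := ⟨n - 3, by omega⟩
  let φ : cycleGraph (k + 3) →g G := 
    ⟨e, fun {i j} hij => hadj i j hij.ne (by have := hne i j hij; omega) (by have := hne i j hij; omega)⟩
  have hsub : ∀ u v, ((cycleGraph.cycle k).map φ).toSubgraph.Adj u v →
      ∃ i j, (cycleGraph (k + 3)).Adj i j ∧ e i = u ∧ e j = v := by
    intro u v huv
    rw [Walk.toSubgraph_map, Subgraph.map_adj] at huv
    obtain ⟨i, j, hij, rfl, rfl⟩ := huv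
    exact ⟨i, j, hij.adj_sub, rfl, rfl⟩
  refine ⟨_, (cycleGraph.cycle k).map φ, ?_, ?_⟩
  · rw [Walk.isHamiltonianCycle_iff_isCycle_and_length_eq]
    refine ⟨cycleGraph.isCycle_cycle.map e.injective, ?_⟩
    rw [Walk.length_map, cycleGraph.length_cycle, ← Fintype.card_congr e, Fintype.card_fin]
  · intro u v huv
    rcases huv with huv | huv
    · obtain ⟨i, j, hij, rfl, rfl⟩ := hsub u v huv
      exact φ.map_adj hij
    -- The distance defaults to zero for unreachable pairs, so distance two yields an actual path of
    -- length two.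
    · have hr : ((cycleGraph.cycle k).map φ).toSubgraph.spanningCoe.Reachable u v :=
        Reachable.of_dist_ne_zero (by omega)
      obtain ⟨p, hp⟩ := hr.exists_walk_length_eq_dist
      rw [huv] at hp
      have huv' : u ≠ v := by rintro rfl; simp at huv
      obtain ⟨w, huw, hwv⟩ : ∃ w, ((cycleGraph.cycle k).map φ).toSubgraph.Adj u w ∧
          ((cycleGraph.cycle k).map φ).toSubgraph.Adj w v := by
        cases p with
        | nil => simp at hp
        | cons h q =>
          cases q with
          | nil => simp at hp
          | cons h' q =>
            cases q with
            | nil => exact ⟨_, h, h'⟩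
            | cons h'' q => simp at hp
      obtain ⟨i, j, hij, rfl, rfl⟩ := hsub u w huw
      obtain ⟨j', l, hjl, hj, rfl⟩ := hsub _ v hwv
      obtain rfl := e.injective hj
      have h1 := hne _ _ hij
      have h2 := hne _ _ hjl
      have hil : i ≠ l := fun h => huv' (congrArg e h)
      have := i.isLt
      have := l.isLt
      have := j'.isLt
      exact hadj i l hil (by omega) (by omega)

/-- List the vertices in the order of their labels. -/
theorem hasHamiltonianSquare_of_label {V : Type*} [Fintype V] [DecidableEq V]
    (G : SimpleGraph V) (hcard : 5 ≤ Fintype.card V) (f : V → ℕ)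
    (h : ∀ u v : V, u ≠ v → ¬ G.Adj u v → f u ≤ f v → f u < f v ∧
      (∃ w w', w ≠ w' ∧ (f u < f w ∧ f w < f v) ∧ (f u < f w' ∧ f w' < f v)) ∧
      (∃ w w', w ≠ w' ∧ (f w < f u ∨ f v < f w) ∧ (f w' < f u ∨ f v < f w'))) :
    G.HasHamiltonianSquare := by
  -- Ties within a block are broken by an arbitrary numbering. This is harmless, since vertices with
  -- equal labels are adjacent by `h`.
  let g : V → ℕ ×ₗ Fin (Fintype.card V) := fun v => toLex (f v, Fintype.equivFin V v)
  have hg : Function.Injective g := by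
    intro u v huv
    have := congrArg (fun x => (ofLex x).2) huv
    exact (Fintype.equivFin V).injective this
  let _ : LinearOrder V := LinearOrder.lift' g hg
  have hlt : ∀ u v : V, f u < f v → u < v := fun u v huv =>
    show g u < g v from Prod.Lex.toLex_lt_toLex.2 (Or.inl huv)
  have hle : ∀ u v : V, u < v → f u ≤ f v := fun u v huv => by
    by_contra hc
    exact absurd (hlt v u (not_le.1 hc)) (not_lt.2 huv.le)
  let e : Fin (Fintype.card V) ≃o V := Fintype.orderIsoFinOfCardEq V rfl
  have hes : ∀ u v : V, f u < f v → (e.symm u).val < (e.symm v).val := fun u v huv =>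
    e.symm.lt_iff_lt.2 (hlt u v huv)
  refine hasHamiltonianSquare_of_equiv G hcard e.toEquiv fun i j hij hna => ?_
  have hij' : e i < e j := e.lt_iff_lt.2 hij
  obtain ⟨-, ⟨w, w', hw, hw1, hw2⟩, ⟨x, x', hx, hx1, hx2⟩⟩ := h (e i) (e j) hij'.ne hna (hle _ _ hij')
  have hne : ∀ w w' : V, w ≠ w' → (e.symm w).val ≠ (e.symm w').val := fun w w' hw hc =>
    hw (e.symm.injective (Fin.ext hc))
  have hi : ∀ w, f w < f (e i) → (e.symm w).val < i.val := fun w hw => by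
    simpa using hes _ _ hw
  have hi' : ∀ w, f (e i) < f w → i.val < (e.symm w).val := fun w hw => by
    simpa using hes _ _ hw
  have hj : ∀ w, f w < f (e j) → (e.symm w).val < j.val := fun w hw => by
    simpa using hes _ _ hw
  have hj' : ∀ w, f (e j) < f w → j.val < (e.symm w).val := fun w hw => by
    simpa using hes _ _ hw
  have := hi' w hw1.1
  have := hj w hw1.2
  have := hi' w' hw2.1
  have := hj w' hw2.2
  have := hne _ _ hw
  have := hne _ _ hx
  have := (e.symm x).isLt
  have := (e.symm x').isLt
  have := hx1.imp (hi x) (hj' x)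
  have := hx2.imp (hi x') (hj' x')
  have : i.val < j.val := hij
  omega

end SimpleGraph
-- Structure of the complement.
namespace SimpleGraph

variable {V : Type*} {G : SimpleGraph V}

theorem pathGraph_four_isIndContained {a b c d : V} (hab : G.Adj a b) (hbc : G.Adj b c)
    (hcd : G.Adj c d) (hac : Gᶜ.Adj a c) (had : Gᶜ.Adj a d) (hbd : Gᶜ.Adj b d) :
    (pathGraph 4).IsIndContained G := by
  have hac' := hac.2
  have had' := had.2
  have hbd' := hbd.2
  have h1 := hab.ne
  have h2 := hbc.ne
  have h3 := hcd.ne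
  have h4 := hac.ne
  have h5 := had.ne
  have h6 := hbd.ne
  refine ⟨⟨⟨![a, b, c, d], ?_⟩, ?_⟩⟩
  · intro i j hij
    fin_cases i <;> fin_cases j <;> simp_all
  · intro i j
    change G.Adj (![a, b, c, d] i) (![a, b, c, d] j) ↔ _
    fin_cases i <;> fin_cases j <;>
      simp_all [pathGraph_adj, G.adj_comm]

theorem claw_isIndContained {c x y z : V} (hx : G.Adj c x) (hy : G.Adj c y) (hz : G.Adj c z)
    (hxy : Gᶜ.Adj x y) (hyz : Gᶜ.Adj y z) (hxz : Gᶜ.Adj x z) :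
    (completeBipartiteGraph (Fin 1) (Fin 3)).IsIndContained G := by
  have hxy' := hxy.2
  have hyz' := hyz.2
  have hxz' := hxz.2
  have h1 := hx.ne
  have h2 := hy.ne
  have h3 := hz.ne
  have h4 := hxy.ne
  have h5 := hyz.ne
  have h6 := hxz.ne
  refine ⟨⟨⟨Sum.elim (fun _ => c) ![x, y, z], ?_⟩, ?_⟩⟩
  · rintro (i | i) (j | j) hij <;> fin_cases i <;> fin_cases j <;> simp_all
  · intro i j
    change G.Adj (Sum.elim (fun _ => c) ![x, y, z] i) (Sum.elim (fun _ => c) ![x, y, z] j) ↔ _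
    rcases i with i | i <;> rcases j with j | j <;> fin_cases i <;> fin_cases j <;>
      simp_all [G.adj_comm]

/-- In a connected graph without induced `P₄`, nonadjacent vertices have a common neighbour. -/
theorem exists_common_neighbor (hG : G.Connected) (hP4 : ¬ (pathGraph 4).IsIndContained G)
    {u v : V} (huv : Gᶜ.Adj u v) : ∃ c, G.Adj u c ∧ G.Adj c v := by
  suffices h : ∀ {u v : V}, G.Walk u v → u = v ∨ G.Adj u v ∨ ∃ c, G.Adj u c ∧ G.Adj c v by
    obtain ⟨p⟩ := hG.preconnected u v
    rcases h p with h | h | h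
    · exact absurd h huv.ne
    · exact absurd h huv.2
    · exact h
  intro u v p
  induction p with
  | nil => exact Or.inl rfl
  | @cons a b c hab q ih =>
    rcases ih with rfl | h | ⟨d, hbd, hdc⟩
    · exact Or.inr (Or.inl hab)
    · exact Or.inr (Or.inr ⟨b, hab, h⟩)
    · by_contra! hc
      obtain ⟨hne, hna, hcn⟩ := hc
      refine hP4 (pathGraph_four_isIndContained hab hbd hdc ⟨?_, ?_⟩ ⟨hne, hna⟩ ⟨?_, hcn b hab⟩)
      · rintro rfl; exact hna hdc
      · exact fun h => hcn d h hdc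
      · rintro rfl; exact hna hab

/-- Take common neighbours `c` of `x, y` and `d` of `y, z`. Claw-freeness keeps `c` from `z` and `d`
from `x`, so `x c d z` or `x c y d` is an induced path, according to whether `c` and `d` are
adjacent. -/
theorem not_indep_triple (hG : G.Connected)
    (hclaw : ¬ (completeBipartiteGraph (Fin 1) (Fin 3)).IsIndContained G)
    (hP4 : ¬ (pathGraph 4).IsIndContained G) {x y z : V}
    (hxy : Gᶜ.Adj x y) (hyz : Gᶜ.Adj y z) (hxz : Gᶜ.Adj x z) : False := by
  obtain ⟨c, hxc, hcy⟩ := exists_common_neighbor hG hP4 hxy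
  obtain ⟨d, hyd, hdz⟩ := exists_common_neighbor hG hP4 hyz
  have hcz : Gᶜ.Adj c z := ⟨by rintro rfl; exact hxz.2 hxc,
    fun h => hclaw (claw_isIndContained hxc.symm hcy h hxy hyz hxz)⟩
  have hxd : Gᶜ.Adj x d := ⟨by rintro rfl; exact hxy.2 hyd.symm,
    fun h => hclaw (claw_isIndContained h.symm hyd.symm hdz hxy hyz hxz)⟩
  have hcd : c ≠ d := by rintro rfl; exact hcz.2 hdz
  by_cases h : G.Adj c d
  · exact hP4 (pathGraph_four_isIndContained hxc h hdz hxd hxz hcz)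
  · exact hP4 (pathGraph_four_isIndContained hxc hcy hyd hxy hxd ⟨hcd, h⟩)

/-- Vertices with a common non-neighbour have the same non-neighbours: the components of the
complement are complete bipartite graphs. -/
def ComplTwin (G : SimpleGraph V) : Prop :=
  ∀ ⦃u w x y : V⦄, Gᶜ.Adj u x → Gᶜ.Adj w x → Gᶜ.Adj u y → Gᶜ.Adj w y

/-- `P₄` is self-complementary: a failure gives the path `w x u y` in `Gᶜ`, with no chords because
`Gᶜ` has no triangle, hence the induced path `x y w u` in `G`. -/
theorem complTwin_of_free (hG : G.Connected)
    (hclaw : ¬ (completeBipartiteGraph (Fin 1) (Fin 3)).IsIndContained G)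
    (hP4 : ¬ (pathGraph 4).IsIndContained G) : G.ComplTwin := by
  intro u w x y hux hwx huy
  have htri := @not_indep_triple V G hG hclaw hP4
  by_contra hwy
  have hne : w ≠ y := by rintro rfl; exact htri hux hwx.symm huy
  have hadj : G.Adj w y := by
    by_contra h; exact hwy ⟨hne, h⟩
  have huw : G.Adj u w := by
    by_contra h
    exact htri ⟨by rintro rfl; exact hwy huy, h⟩ hwx hux
  have hxy : G.Adj x y := by
    by_contra h
    exact htri hux ⟨by rintro rfl; exact hwy hwx, h⟩ huy
  exact hP4 (pathGraph_four_isIndContained hxy hadj.symm huw.symm hwx.symm hux.symm huy.symm)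

theorem ComplTwin.not_triangle (h : G.ComplTwin) {u v x : V} (huv : Gᶜ.Adj u v)
    (hu : Gᶜ.Adj u x) (hv : Gᶜ.Adj v x) : False :=
  (h hu hv huv).ne rfl

theorem ComplTwin.adj_iff (h : G.ComplTwin) {u v x y : V} (huv : Gᶜ.Adj u v)
    (hxy : Gᶜ.Adj x y) : Gᶜ.Adj u x ↔ Gᶜ.Adj v y :=
  ⟨fun hx => h hx.symm huv.symm hxy, fun hy => h hy.symm huv hxy.symm⟩

theorem ComplTwin.exists_bipartition (h : G.ComplTwin) :
    ∃ τ : V → Prop, ∀ x y, Gᶜ.Adj x y → (τ x ↔ ¬ τ y) := by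
  have key : ∀ {r x : V}, Gᶜ.Walk r x → ∀ y, Gᶜ.Adj x y → Gᶜ.Adj r x ∨ Gᶜ.Adj r y := by
    intro r x p
    induction p with
    | nil => exact fun y hy => Or.inr hy
    | cons hrs q ih =>
      intro y hxy
      rcases ih y hxy with hs | hs
      · exact Or.inr (h hs hxy.symm hrs.symm).symm
      · exact Or.inl (h hs hxy hrs.symm).symm
  -- Fix a root in each component of `Gᶜ`; `τ` holds on the neighbours of the root.
  refine ⟨fun x => Gᶜ.Adj (Gᶜ.connectedComponentMk x).out x, fun x y hxy => ?_⟩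
  have hc : Gᶜ.connectedComponentMk x = Gᶜ.connectedComponentMk y :=
    ConnectedComponent.sound hxy.reachable
  have hr : Gᶜ.Reachable (Gᶜ.connectedComponentMk y).out x :=
    ConnectedComponent.exact ((Quot.out_eq _).trans hc.symm)
  obtain ⟨p⟩ := hr
  simp only [hc]
  refine ⟨fun hx hy => h.not_triangle hxy hx.symm hy.symm, fun hy => ?_⟩
  exact (key p y hxy).resolve_right hy

theorem IsVertexKConnected.connected [Fintype V] {k : ℕ} (hk : 0 < k)
    (hG : G.IsVertexKConnected k) : G.Connected := by
  have h := hG.2 ∅ (by simpa using hk)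
  obtain ⟨⟨x, -⟩⟩ := h.nonempty
  have : Nonempty V := ⟨x⟩
  refine ⟨fun u v => ?_⟩
  exact (h.preconnected ⟨u, by simp⟩ ⟨v, by simp⟩).map (Embedding.induce _).toHom

/-- Deleting every vertex outside the component of `u v` leaves its two sides, with no edge of `G`
between them, so the deleted set is a cut. -/
theorem IsVertexKConnected.le_ncard [Fintype V] {k : ℕ} (hG : G.IsVertexKConnected k)
    (h : G.ComplTwin) {u v : V} (huv : Gᶜ.Adj u v) :
    k ≤ {x | ¬ Gᶜ.Adj u x ∧ ¬ Gᶜ.Adj v x}.ncard := by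
  classical
  by_contra! hlt
  rw [Set.ncard_eq_toFinset_card'] at hlt
  have hc := hG.2 _ hlt
  have key : ∀ {a b}, (G.induce (({x | ¬ Gᶜ.Adj u x ∧ ¬ Gᶜ.Adj v x}.toFinset : Set V)ᶜ)).Walk a b →
      Gᶜ.Adj v a → Gᶜ.Adj v b := by
    intro a b p
    induction p with
    | nil => exact id
    | @cons a b c hab q ih =>
      intro hva
      refine ih ?_
      have hb : ¬ (¬ Gᶜ.Adj u b ∧ ¬ Gᶜ.Adj v b) := fun hh => b.2 (Finset.mem_coe.2 (Set.mem_toFinset.2 hh))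
      by_contra hvb
      have hub : Gᶜ.Adj u b := by tauto
      exact (h huv hva.symm hub).2 hab
  obtain ⟨p⟩ := hc.preconnected ⟨u, by simp [huv.symm.ne, huv.symm.2]⟩ ⟨v, by simp [huv.ne, huv.2]⟩
  exact (key p huv.symm).ne rfl

end SimpleGraph
-- Block orders built from components of the complement.
namespace SimpleGraph

variable {V : Type*} {G : SimpleGraph V}

/-- Edges `u v` and `u' v'` of the complement lying in different components, when these components
are complete bipartite. -/
structure ComplEdgePair (G : SimpleGraph V) (u v u' v' : V) : Prop where
  twin : G.ComplTwin
  left : Gᶜ.Adj u v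
  right : Gᶜ.Adj u' v'
  not_adj_left : ¬ Gᶜ.Adj u u'
  not_adj_right : ¬ Gᶜ.Adj v u'

namespace ComplEdgePair

variable {u v u' v' : V}

theorem swap_left (h : ComplEdgePair G u v u' v') : ComplEdgePair G v u u' v' :=
  ⟨h.twin, h.left.symm, h.right, h.not_adj_right, h.not_adj_left⟩

theorem swap_right (h : ComplEdgePair G u v u' v') : ComplEdgePair G u v v' u' :=
  ⟨h.twin, h.left, h.right.symm,
    fun hc => h.not_adj_right ((h.twin.adj_iff h.left h.right.symm).1 hc),
    fun hc => h.not_adj_left ((h.twin.adj_iff h.left.symm h.right.symm).1 hc)⟩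

theorem swap (h : ComplEdgePair G u v u' v') : ComplEdgePair G u' v' u v :=
  ⟨h.twin, h.right, h.left, fun hc => h.not_adj_left hc.symm,
    fun hc => h.swap_right.not_adj_left hc.symm⟩

theorem not_adj_of_adj (h : ComplEdgePair G u v u' v') {x : V} (hx : Gᶜ.Adj u x) :
    ¬ Gᶜ.Adj v x ∧ ¬ Gᶜ.Adj u' x ∧ ¬ Gᶜ.Adj v' x :=
  ⟨h.twin.not_triangle h.left hx,
    fun hx' => h.not_adj_right (h.twin hx hx' h.left).symm,
    fun hx' => h.swap_right.not_adj_right (h.twin hx hx' h.left).symm⟩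

/-- An edge of `Gᶜ` joins the two sides of one of the two components or avoids both components. -/
theorem adj_cases (h : ComplEdgePair G u v u' v') {x y : V} (hxy : Gᶜ.Adj x y) :
    (Gᶜ.Adj u x ∧ Gᶜ.Adj v y) ∨ (Gᶜ.Adj v x ∧ Gᶜ.Adj u y) ∨
    (Gᶜ.Adj u' x ∧ Gᶜ.Adj v' y) ∨ (Gᶜ.Adj v' x ∧ Gᶜ.Adj u' y) ∨
    ((¬ Gᶜ.Adj u x ∧ ¬ Gᶜ.Adj v x ∧ ¬ Gᶜ.Adj u' x ∧ ¬ Gᶜ.Adj v' x) ∧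
      (¬ Gᶜ.Adj u y ∧ ¬ Gᶜ.Adj v y ∧ ¬ Gᶜ.Adj u' y ∧ ¬ Gᶜ.Adj v' y)) := by
  have h1 := h.twin.adj_iff h.left hxy
  have h2 := h.twin.adj_iff h.left.symm hxy
  have h3 := h.twin.adj_iff h.right hxy
  have h4 := h.twin.adj_iff h.right.symm hxy
  tauto

end ComplEdgePair

variable [Fintype V] [DecidableEq V]

/-- Six cyclically arranged nonempty blocks such that nonadjacent vertices lie in opposite blocks. -/
theorem hasHamiltonianSquare_of_six_blocks (hcard : 5 ≤ Fintype.card V) (f : V → ℕ)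
    (hf6 : ∀ x, f x < 6) (hsurj : ∀ i < 6, ∃ x, f x = i)
    (h : ∀ x y, Gᶜ.Adj x y → f x ≤ f y → f y = f x + 3) : G.HasHamiltonianSquare := by
  refine hasHamiltonianSquare_of_label G hcard f fun x y hne hna hle => ?_
  have hy := h x y ⟨hne, hna⟩ hle
  have hy6 := hf6 y
  have hw : ∀ i j, i < 6 → j < 6 → i ≠ j → ∃ w w', w ≠ w' ∧ f w = i ∧ f w' = j := by
    intro i j hi hj hij
    obtain ⟨w, rfl⟩ := hsurj i hi
    obtain ⟨w', rfl⟩ := hsurj j hj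
    exact ⟨w, w', fun hc => hij (congrArg f hc), rfl, rfl⟩
  refine ⟨by omega, ?_, ?_⟩
  · obtain ⟨w, w', hw, h1, h2⟩ := hw (f x + 1) (f x + 2) (by omega) (by omega) (by omega)
    exact ⟨w, w', hw, by omega, by omega⟩
  · obtain h0 | h0 | h0 : f x = 0 ∨ f x = 1 ∨ f x = 2 := by omega
    · obtain ⟨w, w', hw, h1, h2⟩ := hw 4 5 (by omega) (by omega) (by omega)
      exact ⟨w, w', hw, by omega, by omega⟩
    · obtain ⟨w, w', hw, h1, h2⟩ := hw 0 5 (by omega) (by omega) (by omega)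
      exact ⟨w, w', hw, by omega, by omega⟩
    · obtain ⟨w, w', hw, h1, h2⟩ := hw 0 1 (by omega) (by omega) (by omega)
      exact ⟨w, w', hw, by omega, by omega⟩

namespace ComplEdgePair

variable {u v u' v' : V}

/-- The case where some two vertices lie outside both components. -/
theorem hasHamiltonianSquare_of_two_outside (h : ComplEdgePair G u v u' v')
    (hcard : 5 ≤ Fintype.card V) (τ : V → Prop)
    (hτ : ∀ x y, Gᶜ.Adj x y →
      (¬ Gᶜ.Adj u x ∧ ¬ Gᶜ.Adj v x ∧ ¬ Gᶜ.Adj u' x ∧ ¬ Gᶜ.Adj v' x) → (τ x ↔ ¬ τ y)) {s t : V}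
    (hs : ¬ Gᶜ.Adj u s ∧ ¬ Gᶜ.Adj v s ∧ ¬ Gᶜ.Adj u' s ∧ ¬ Gᶜ.Adj v' s)
    (ht : ¬ Gᶜ.Adj u t ∧ ¬ Gᶜ.Adj v t ∧ ¬ Gᶜ.Adj u' t ∧ ¬ Gᶜ.Adj v' t)
    (hsτ : τ s) (htτ : ¬ τ t) : G.HasHamiltonianSquare := by
  classical
  -- Opposite blocks hold the two sides of a component, or the two `τ`-classes of the outside
  -- vertices.
  let f : V → ℕ := fun x => if Gᶜ.Adj u x then 0 else if Gᶜ.Adj v x then 3 else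
    if Gᶜ.Adj u' x then 1 else if Gᶜ.Adj v' x then 4 else if τ x then 2 else 5
  have f0 : ∀ x, Gᶜ.Adj u x → f x = 0 := fun x hx => if_pos hx
  have f3 : ∀ x, Gᶜ.Adj v x → f x = 3 := fun x hx => by
    simp only [f, hx, h.swap_left.not_adj_of_adj hx, if_true, if_false]
  have f1 : ∀ x, Gᶜ.Adj u' x → f x = 1 := fun x hx => by
    simp only [f, hx, h.swap.not_adj_of_adj hx, if_true, if_false]
  have f4 : ∀ x, Gᶜ.Adj v' x → f x = 4 := fun x hx => by
    simp only [f, hx, h.swap.swap_left.not_adj_of_adj hx, if_true, if_false]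
  have f2 : ∀ x, (¬ Gᶜ.Adj u x ∧ ¬ Gᶜ.Adj v x ∧ ¬ Gᶜ.Adj u' x ∧ ¬ Gᶜ.Adj v' x) → τ x → f x = 2 :=
    fun x hx hx' => by simp only [f, hx, hx', if_true, if_false]
  have f5 : ∀ x, (¬ Gᶜ.Adj u x ∧ ¬ Gᶜ.Adj v x ∧ ¬ Gᶜ.Adj u' x ∧ ¬ Gᶜ.Adj v' x) → ¬ τ x → f x = 5 :=
    fun x hx hx' => by simp only [f, hx, hx', if_false]
  refine hasHamiltonianSquare_of_six_blocks hcard f ?_ ?_ ?_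
  · intro x
    simp only [f]
    split_ifs <;> omega
  · intro i hi
    interval_cases i
    · exact ⟨v, f0 _ h.left⟩
    · exact ⟨v', f1 _ h.right⟩
    · exact ⟨s, f2 _ hs hsτ⟩
    · exact ⟨u, f3 _ h.left.symm⟩
    · exact ⟨u', f4 _ h.right.symm⟩
    · exact ⟨t, f5 _ ht htτ⟩
  · intro x y hxy hle
    obtain ⟨hx, hy⟩ | ⟨hx, hy⟩ | ⟨hx, hy⟩ | ⟨hx, hy⟩ | ⟨hx, hy⟩ := h.adj_cases hxy
    · rw [f0 x hx, f3 y hy]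
    · rw [f3 x hx, f0 y hy] at hle; omega
    · rw [f1 x hx, f4 y hy]
    · rw [f4 x hx, f1 y hy] at hle; omega
    · have := hτ x y hxy hx
      by_cases hτx : τ x
      · rw [f2 x hx hτx, f5 y hy (this.1 hτx)]
      · rw [f5 x hx hτx, f2 y hy (by tauto)] at hle; omega

/-- The case where a single vertex lies outside both components. -/
theorem hasHamiltonianSquare_of_one_outside (h : ComplEdgePair G u v u' v')
    (hcard : 5 ≤ Fintype.card V)
    (hout : ∀ x y, Gᶜ.Adj x y →
      ¬ (¬ Gᶜ.Adj u x ∧ ¬ Gᶜ.Adj v x ∧ ¬ Gᶜ.Adj u' x ∧ ¬ Gᶜ.Adj v' x)) {s b d : V}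
    (hs : ¬ Gᶜ.Adj u s ∧ ¬ Gᶜ.Adj v s ∧ ¬ Gᶜ.Adj u' s ∧ ¬ Gᶜ.Adj v' s)
    (hb : Gᶜ.Adj u b) (hbv : b ≠ v) (hd : Gᶜ.Adj u' d) (hdv : d ≠ v') :
    G.HasHamiltonianSquare := by
  classical
  -- Nonadjacent vertices lie in blocks 0 and 3, or 1 and 4. One arc between them contains two
  -- blocks; the other is a single block, 4 or 0, which has two vertices thanks to `b` or `d`.
  let f : V → ℕ := fun x => if Gᶜ.Adj u x then 4 else if Gᶜ.Adj v x then 1 else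
    if Gᶜ.Adj u' x then 0 else if Gᶜ.Adj v' x then 3 else 2
  have f4 : ∀ x, Gᶜ.Adj u x → f x = 4 := fun x hx => if_pos hx
  have f1 : ∀ x, Gᶜ.Adj v x → f x = 1 := fun x hx => by
    simp only [f, hx, h.swap_left.not_adj_of_adj hx, if_true, if_false]
  have f0 : ∀ x, Gᶜ.Adj u' x → f x = 0 := fun x hx => by
    simp only [f, hx, h.swap.not_adj_of_adj hx, if_true, if_false]
  have f3 : ∀ x, Gᶜ.Adj v' x → f x = 3 := fun x hx => by
    simp only [f, hx, h.swap.swap_left.not_adj_of_adj hx, if_true, if_false]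
  have f2 : f s = 2 := by simp only [f, hs, if_false]
  have hu := f1 u h.left.symm
  have hv := f4 v h.left
  have hu' := f3 u' h.right.symm
  have hv' := f0 v' h.right
  have hb4 := f4 b hb
  have hd0 := f0 d hd
  have hne : ∀ {w w'}, f w ≠ f w' → w ≠ w' := fun hw hc => hw (congrArg f hc)
  refine hasHamiltonianSquare_of_label G hcard f fun x y hxy hna hle => ?_
  obtain ⟨hx, hy⟩ | ⟨hx, hy⟩ | ⟨hx, hy⟩ | ⟨hx, hy⟩ | ⟨hx, hy⟩ := h.adj_cases ⟨hxy, hna⟩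
  · rw [f4 x hx, f1 y hy] at hle; omega
  · rw [f1 x hx, f4 y hy]
    exact ⟨by omega, ⟨s, u', hne (by omega), by omega, by omega⟩,
      ⟨d, v', hdv, by omega, by omega⟩⟩
  · rw [f0 x hx, f3 y hy]
    exact ⟨by omega, ⟨s, u, hne (by omega), by omega, by omega⟩,
      ⟨b, v, hbv, by omega, by omega⟩⟩
  · rw [f3 x hx, f0 y hy] at hle; omega
  · exact absurd hx (hout x y ⟨hxy, hna⟩)

/-- The case where both components span the graph and all four sides have at least two vertices. -/
theorem hasHamiltonianSquare_of_two_le (h : ComplEdgePair G u v u' v')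
    (hcard : 5 ≤ Fintype.card V)
    (hcover : ∀ x, Gᶜ.Adj u x ∨ Gᶜ.Adj v x ∨ Gᶜ.Adj u' x ∨ Gᶜ.Adj v' x) {a b c d : V}
    (ha : Gᶜ.Adj u a) (hav : a ≠ v) (hb : Gᶜ.Adj v b) (hbu : b ≠ u)
    (hc : Gᶜ.Adj u' c) (hcv : c ≠ v') (hd : Gᶜ.Adj v' d) (hdu : d ≠ u') :
    G.HasHamiltonianSquare := by
  classical
  -- The sides of the two components alternate, so each arc between nonadjacent vertices contains a
  -- whole side of the other component.
  let f : V → ℕ := fun x => if Gᶜ.Adj u x then 0 else if Gᶜ.Adj v x then 2 else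
    if Gᶜ.Adj u' x then 1 else 3
  have f0 : ∀ x, Gᶜ.Adj u x → f x = 0 := fun x hx => if_pos hx
  have f2 : ∀ x, Gᶜ.Adj v x → f x = 2 := fun x hx => by
    simp only [f, hx, h.swap_left.not_adj_of_adj hx, if_true, if_false]
  have f1 : ∀ x, Gᶜ.Adj u' x → f x = 1 := fun x hx => by
    simp only [f, hx, h.swap.not_adj_of_adj hx, if_true, if_false]
  have f3 : ∀ x, Gᶜ.Adj v' x → f x = 3 := fun x hx => by
    simp only [f, h.swap.swap_left.not_adj_of_adj hx, if_false]
  have hu := f2 u h.left.symm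
  have hv := f0 v h.left
  have hu' := f3 u' h.right.symm
  have hv' := f1 v' h.right
  have ha' := f0 a ha
  have hb' := f2 b hb
  have hc' := f1 c hc
  have hd' := f3 d hd
  refine hasHamiltonianSquare_of_label G hcard f fun x y hxy hna hle => ?_
  obtain ⟨hx, hy⟩ | ⟨hx, hy⟩ | ⟨hx, hy⟩ | ⟨hx, hy⟩ | ⟨hx, hy⟩ := h.adj_cases ⟨hxy, hna⟩
  · rw [f0 x hx, f2 y hy]
    exact ⟨by omega, ⟨c, v', hcv, by omega, by omega⟩, ⟨d, u', hdu, by omega, by omega⟩⟩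
  · rw [f2 x hx, f0 y hy] at hle; omega
  · rw [f1 x hx, f3 y hy]
    exact ⟨by omega, ⟨b, u, hbu, by omega, by omega⟩, ⟨a, v, hav, by omega, by omega⟩⟩
  · rw [f3 x hx, f1 y hy] at hle; omega
  · exact absurd (hcover x) (by tauto)

end ComplEdgePair

/-- A set with four elements splits into two parts with two elements each. -/
theorem exists_split_of_four_le_ncard {W : Type*} [Finite W] {s : Set W} (hs : 4 ≤ s.ncard) :
    ∃ (τ : W → Prop) (a b c d : W), (a ∈ s ∧ b ∈ s ∧ c ∈ s ∧ d ∈ s) ∧ a ≠ b ∧ c ≠ d ∧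
      τ a ∧ τ b ∧ ¬ τ c ∧ ¬ τ d := by
  obtain ⟨t, hts, ht⟩ := Set.exists_subset_card_eq (s := s) (n := 2) (by omega)
  have hd := Set.ncard_sdiff_add_ncard_of_subset hts
  obtain ⟨a, b, ha, hb, hab⟩ := (Set.one_lt_ncard_iff (s := t)).1 (by omega)
  obtain ⟨c, d, hc, hd, hcd⟩ := (Set.one_lt_ncard_iff (s := s \ t)).1 (by omega)
  exact ⟨(· ∈ t), a, b, c, d, ⟨hts ha, hts hb, hc.1, hd.1⟩, hab, hcd, ha, hb, hc.2, hd.2⟩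

namespace ComplEdgePair

variable {u v u' v' : V}

/-- The case where both components span the graph and each has a side with at least four
vertices. -/
theorem hasHamiltonianSquare_of_four_le (h : ComplEdgePair G u v u' v')
    (hcard : 5 ≤ Fintype.card V)
    (hcover : ∀ x, Gᶜ.Adj u x ∨ Gᶜ.Adj v x ∨ Gᶜ.Adj u' x ∨ Gᶜ.Adj v' x)
    (hu4 : 4 ≤ (Gᶜ.neighborSet u).ncard) (hu4' : 4 ≤ (Gᶜ.neighborSet u').ncard) :
    G.HasHamiltonianSquare := by
  classical
  obtain ⟨τ, a, b, c, d, ⟨ha, hb, hc, hd⟩, hab, hcd, haτ, hbτ, hcτ, hdτ⟩ :=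
    exists_split_of_four_le_ncard hu4
  obtain ⟨τ', a', b', c', d', ⟨ha', hb', hc', hd'⟩, hab', hcd', haτ', hbτ', hcτ', hdτ'⟩ :=
    exists_split_of_four_le_ncard hu4'
  rw [mem_neighborSet] at ha hb hc hd ha' hb' hc' hd'
  -- Each large side is halved around the small side of the other component. Either arc between
  -- nonadjacent vertices then contains a half with at least two vertices, even if the small sides
  -- are singletons.
  let f : V → ℕ := fun x => if Gᶜ.Adj u x then (if τ x then 0 else 2) else
    if Gᶜ.Adj v x then 4 else if Gᶜ.Adj u' x then (if τ' x then 3 else 5) else 1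
  have f0 : ∀ x, Gᶜ.Adj u x → τ x → f x = 0 := fun x hx hx' => by
    simp only [f, hx, hx', if_true]
  have f2 : ∀ x, Gᶜ.Adj u x → ¬ τ x → f x = 2 := fun x hx hx' => by
    simp only [f, hx, hx', if_true, if_false]
  have f4 : ∀ x, Gᶜ.Adj v x → f x = 4 := fun x hx => by
    simp only [f, hx, h.swap_left.not_adj_of_adj hx, if_true, if_false]
  have f3 : ∀ x, Gᶜ.Adj u' x → τ' x → f x = 3 := fun x hx hx' => by
    simp only [f, hx, hx', h.swap.not_adj_of_adj hx, if_true, if_false]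
  have f5 : ∀ x, Gᶜ.Adj u' x → ¬ τ' x → f x = 5 := fun x hx hx' => by
    simp only [f, hx, hx', h.swap.not_adj_of_adj hx, if_true, if_false]
  have f1 : ∀ x, Gᶜ.Adj v' x → f x = 1 := fun x hx => by
    simp only [f, h.swap.swap_left.not_adj_of_adj hx, if_false]
  have fu : ∀ x, Gᶜ.Adj u x → f x = 0 ∨ f x = 2 := fun x hx =>
    (em (τ x)).imp (f0 x hx) (f2 x hx)
  have fu' : ∀ x, Gᶜ.Adj u' x → f x = 3 ∨ f x = 5 := fun x hx =>
    (em (τ' x)).imp (f3 x hx) (f5 x hx)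
  have ea := f0 a ha haτ
  have eb := f0 b hb hbτ
  have ec := f2 c hc hcτ
  have ed := f2 d hd hdτ
  have ea' := f3 a' ha' haτ'
  have eb' := f3 b' hb' hbτ'
  have ec' := f5 c' hc' hcτ'
  have ed' := f5 d' hd' hdτ'
  refine hasHamiltonianSquare_of_label G hcard f fun x y hxy hna hle => ?_
  obtain ⟨hx, hy⟩ | ⟨hx, hy⟩ | ⟨hx, hy⟩ | ⟨hx, hy⟩ | ⟨hx, hy⟩ := h.adj_cases ⟨hxy, hna⟩
  · have hy := f4 y hy
    have hx := fu x hx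
    exact ⟨by omega, ⟨a', b', hab', by omega, by omega⟩, ⟨c', d', hcd', by omega, by omega⟩⟩
  · have hx := f4 x hx
    have hy := fu y hy
    omega
  · have hy := f1 y hy
    have hx := fu' x hx
    omega
  · have hx := f1 x hx
    have hy := fu' y hy
    exact ⟨by omega, ⟨c, d, hcd, by omega, by omega⟩, ⟨a, b, hab, by omega, by omega⟩⟩
  · exact absurd (hcover x) (by tauto)

end ComplEdgePair

/-- The case of a complement with a single nontrivial component. -/
theorem ComplTwin.hasHamiltonianSquare_of_single (h : G.ComplTwin)
    (hcard : 5 ≤ Fintype.card V) {u v : V} (huv : Gᶜ.Adj u v)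
    (hcover : ∀ x y, Gᶜ.Adj x y → Gᶜ.Adj u x ∨ Gᶜ.Adj v x)
    (h4 : 4 ≤ {x | ¬ Gᶜ.Adj u x ∧ ¬ Gᶜ.Adj v x}.ncard) : G.HasHamiltonianSquare := by
  classical
  obtain ⟨τ, a, b, c, d, ⟨ha, hb, hc, hd⟩, hab, hcd, haτ, hbτ, hcτ, hdτ⟩ :=
    exists_split_of_four_le_ncard h4
  rw [Set.mem_ofPred_eq] at ha hb hc hd
  -- The outside vertices, halved by `τ`, separate the two sides of the component.
  let f : V → ℕ := fun x => if Gᶜ.Adj u x then 1 else if Gᶜ.Adj v x then 3 else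
    if τ x then 0 else 2
  have f1 : ∀ x, Gᶜ.Adj u x → f x = 1 := fun x hx => if_pos hx
  have f3 : ∀ x, Gᶜ.Adj v x → f x = 3 := fun x hx => by
    have hx' : ¬ Gᶜ.Adj u x := fun hc => h.not_triangle huv hc hx
    simp only [f, hx, hx', if_true, if_false]
  have ea : f a = 0 := by simp only [f, ha, haτ, if_true, if_false]
  have eb : f b = 0 := by simp only [f, hb, hbτ, if_true, if_false]
  have ec : f c = 2 := by simp only [f, hc, hcτ, if_false]
  have ed : f d = 2 := by simp only [f, hd, hdτ, if_false]
  refine hasHamiltonianSquare_of_label G hcard f fun x y hxy hna hle => ?_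
  rcases hcover x y ⟨hxy, hna⟩ with hx | hx
  · have hy := f3 y ((h.adj_iff huv ⟨hxy, hna⟩).1 hx)
    have hx := f1 x hx
    exact ⟨by omega, ⟨c, d, hcd, by omega, by omega⟩, ⟨a, b, hab, by omega, by omega⟩⟩
  · have hy := f1 y ((h.adj_iff huv.symm ⟨hxy, hna⟩).1 hx)
    have hx := f3 x hx
    omega

end SimpleGraph
-- Recognising the exceptional families.
namespace SimpleGraph

variable {V : Type*} {G : SimpleGraph V}

namespace ComplEdgePair

variable {u v u' v' : V}

theorem adj_iff_ne (h : ComplEdgePair G u v u' v') {x y : V} (hx : Gᶜ.Adj u x)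
    (hy : Gᶜ.Adj u y) : G.Adj x y ↔ x ≠ y :=
  ⟨fun h => h.ne, fun hne => by
    by_contra hc
    exact h.twin.not_triangle hx hy ⟨hne, hc⟩⟩

theorem not_adj (h : ComplEdgePair G u v u' v') {x y : V} (hx : Gᶜ.Adj u x)
    (hy : Gᶜ.Adj v y) : ¬ G.Adj x y :=
  (h.twin h.left.symm hx.symm hy).2

theorem adj (h : ComplEdgePair G u v u' v') {x y : V} (hx : Gᶜ.Adj u x)
    (hy : Gᶜ.Adj u' y) : G.Adj x y := by
  by_contra hc
  have hne : x ≠ y := by rintro rfl; exact (h.not_adj_of_adj hx).2.1 hy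
  have := (h.twin.adj_iff h.left ⟨hne, hc⟩).1 hx
  exact (h.swap.not_adj_of_adj hy).2.2 this

variable [Fintype V]

/-- Each side is a clique in `G`, the two sides of a component are mutually nonadjacent, and
distinct components are completely joined. -/
theorem nonempty_iso (h : ComplEdgePair G u v u' v')
    (hcover : ∀ x, Gᶜ.Adj u x ∨ Gᶜ.Adj v x ∨ Gᶜ.Adj u' x ∨ Gᶜ.Adj v' x) {a b c d : ℕ}
    (ha : (Gᶜ.neighborSet u).ncard = a) (hb : (Gᶜ.neighborSet v).ncard = b)
    (hc : (Gᶜ.neighborSet u').ncard = c) (hd : (Gᶜ.neighborSet v').ncard = d) :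
    Nonempty (G ≃g joinOfCompletePairs a b c d) := by
  have ea := (Finite.equivFinOfCardEq ((Nat.card_coe_set_eq _).trans ha)).symm
  have eb := (Finite.equivFinOfCardEq ((Nat.card_coe_set_eq _).trans hb)).symm
  have ec := (Finite.equivFinOfCardEq ((Nat.card_coe_set_eq _).trans hc)).symm
  have ed := (Finite.equivFinOfCardEq ((Nat.card_coe_set_eq _).trans hd)).symm
  let F : (Fin a ⊕ Fin b) ⊕ (Fin c ⊕ Fin d) → V :=
    Sum.elim (Sum.elim (fun i => ea i) (fun i => eb i)) (Sum.elim (fun i => ec i) (fun i => ed i))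
  have hadj : ∀ i j, G.Adj (F i) (F j) ↔ (joinOfCompletePairs a b c d).Adj i j := by
    rintro ((i | i) | (i | i)) ((j | j) | (j | j)) <;>
      simp only [F, joinOfCompletePairs, disjointJoin, Sum.elim_inl, Sum.elim_inr, sup_adj,
        sum_adj, completeBipartiteGraph_adj, completeGraph, top_adj, Sum.isLeft_inl, Sum.isLeft_inr,
        Sum.isRight_inl, Sum.isRight_inr, Bool.false_eq_true, and_false, or_false, and_true, or_true, iff_true, iff_false]
    · exact (h.adj_iff_ne (ea i).2 (ea j).2).trans
        (by rw [Ne, Subtype.val_inj, EmbeddingLike.apply_eq_iff_eq])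
    · exact h.not_adj (ea i).2 (eb j).2
    · exact h.adj (ea i).2 (ec j).2
    · exact h.swap_right.adj (ea i).2 (ed j).2
    · exact h.swap_left.not_adj (eb i).2 (ea j).2
    · exact (h.swap_left.adj_iff_ne (eb i).2 (eb j).2).trans
        (by rw [Ne, Subtype.val_inj, EmbeddingLike.apply_eq_iff_eq])
    · exact h.swap_left.adj (eb i).2 (ec j).2
    · exact h.swap_left.swap_right.adj (eb i).2 (ed j).2
    · exact h.swap.adj (ec i).2 (ea j).2
    · exact h.swap.swap_right.adj (ec i).2 (eb j).2
    · exact (h.swap.adj_iff_ne (ec i).2 (ec j).2).trans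
        (by rw [Ne, Subtype.val_inj, EmbeddingLike.apply_eq_iff_eq])
    · exact h.swap.not_adj (ec i).2 (ed j).2
    · exact h.swap.swap_left.adj (ed i).2 (ea j).2
    · exact h.swap.swap_left.swap_right.adj (ed i).2 (eb j).2
    · exact h.swap.swap_left.not_adj (ed i).2 (ec j).2
    · exact (h.swap.swap_left.adj_iff_ne (ed i).2 (ed j).2).trans
        (by rw [Ne, Subtype.val_inj, EmbeddingLike.apply_eq_iff_eq])
  have hinj : Function.Injective F := by
    have na := fun i => h.not_adj_of_adj (ea i).2
    have nb := fun i => h.swap_left.not_adj_of_adj (eb i).2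
    have nc := fun i => h.swap.not_adj_of_adj (ec i).2
    have nd := fun i => h.swap.swap_left.not_adj_of_adj (ed i).2
    have ma := fun i => (ea i).2
    have mb := fun i => (eb i).2
    have mc := fun i => (ec i).2
    have md := fun i => (ed i).2
    simp only [mem_neighborSet] at ma mb mc md
    rintro ((i | i) | (i | i)) ((j | j) | (j | j)) hij <;>
      simp only [F, Sum.elim_inl, Sum.elim_inr] at hij <;>
      first
        | (rw [Subtype.val_inj, EmbeddingLike.apply_eq_iff_eq] at hij; rw [hij])
        | grind
  have hsurj : Function.Surjective F := by
    intro x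
    rcases hcover x with hx | hx | hx | hx
    · exact ⟨Sum.inl (Sum.inl (ea.symm ⟨x, hx⟩)), by simp [F]⟩
    · exact ⟨Sum.inl (Sum.inr (eb.symm ⟨x, hx⟩)), by simp [F]⟩
    · exact ⟨Sum.inr (Sum.inl (ec.symm ⟨x, hx⟩)), by simp [F]⟩
    · exact ⟨Sum.inr (Sum.inr (ed.symm ⟨x, hx⟩)), by simp [F]⟩
  exact ⟨RelIso.symm ⟨Equiv.ofBijective F ⟨hinj, hsurj⟩, hadj _ _⟩⟩

/-- The unbalanced spanning case, in which one side is a single vertex. -/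
theorem hasHamiltonianSquare_or_iso_of_ncard_eq_one [DecidableEq V]
    (h : ComplEdgePair G u v u' v') (hcard : 5 ≤ Fintype.card V)
    (hcover : ∀ x, Gᶜ.Adj u x ∨ Gᶜ.Adj v x ∨ Gᶜ.Adj u' x ∨ Gᶜ.Adj v' x)
    (h4 : 4 ≤ (Gᶜ.neighborSet u).ncard + (Gᶜ.neighborSet v).ncard)
    (h4' : 4 ≤ (Gᶜ.neighborSet u').ncard + (Gᶜ.neighborSet v').ncard)
    (h1 : (Gᶜ.neighborSet u').ncard = 1) :
    G.HasHamiltonianSquare ∨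
      (∃ m q : ℕ, 1 ≤ m ∧ 1 ≤ q ∧ 4 ≤ m + q ∧
        Nonempty (G ≃g SimpleGraph.joinOfCompletePairs 1 3 m q)) ∨
      (∃ m : ℕ, 3 ≤ m ∧ Nonempty (G ≃g SimpleGraph.joinOfCompletePairs 2 2 1 m)) ∨
      (∃ m : ℕ, 3 ≤ m ∧ Nonempty (G ≃g SimpleGraph.joinOfCompletePairs 2 3 1 m)) ∨
      (∃ m : ℕ, 3 ≤ m ∧ Nonempty (G ≃g SimpleGraph.joinOfCompletePairs 3 3 1 m)) := by
  wlog hle : (Gᶜ.neighborSet u).ncard ≤ (Gᶜ.neighborSet v).ncard generalizing u v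
  · exact this h.swap_left (fun x => by have := hcover x; tauto) (by omega) (by omega)
  have hpos : ∀ {w x}, Gᶜ.Adj w x → 1 ≤ (Gᶜ.neighborSet w).ncard := fun {w x} hx =>
    (Set.ncard_pos).2 ⟨x, hx⟩
  have hu := hpos h.left
  have hv := hpos h.left.symm
  by_cases h3 : (Gᶜ.neighborSet v').ncard = 3
  · exact Or.inr (Or.inl ⟨_, _, hu, hv, h4,
      h.swap.nonempty_iso (fun x => by have := hcover x; tauto) h1 h3 rfl rfl⟩)
  -- The side opposite the singleton now has at least four vertices, since its size is at least
  -- three and not three.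
  by_cases hv4 : 4 ≤ (Gᶜ.neighborSet v).ncard
  · exact Or.inl (h.swap_left.swap_right.hasHamiltonianSquare_of_four_le hcard
      (fun x => by have := hcover x; tauto) hv4 (by omega))
  -- Both sides have at most three vertices and together at least four.
  obtain ⟨ha, hb⟩ | ⟨ha, hb⟩ | ⟨ha, hb⟩ | ⟨ha, hb⟩ :
      ((Gᶜ.neighborSet u).ncard = 1 ∧ (Gᶜ.neighborSet v).ncard = 3) ∨
      ((Gᶜ.neighborSet u).ncard = 2 ∧ (Gᶜ.neighborSet v).ncard = 2) ∨
      ((Gᶜ.neighborSet u).ncard = 2 ∧ (Gᶜ.neighborSet v).ncard = 3) ∨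
      ((Gᶜ.neighborSet u).ncard = 3 ∧ (Gᶜ.neighborSet v).ncard = 3) := by omega
  all_goals have hiso := h.nonempty_iso hcover ha hb h1 rfl
  · exact Or.inr (Or.inl ⟨1, _, le_rfl, by omega, by omega, hiso⟩)
  · exact Or.inr (Or.inr (Or.inl ⟨_, by omega, hiso⟩))
  · exact Or.inr (Or.inr (Or.inr (Or.inl ⟨_, by omega, hiso⟩)))
  · exact Or.inr (Or.inr (Or.inr (Or.inr ⟨_, by omega, hiso⟩)))

/-- A lower bound on the size of the component of `u' v'` when all vertices outside a set `s` lie in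
the two components. -/
theorem le_ncard_add_ncard_add (h : ComplEdgePair G u v u' v') {k : ℕ}
    (hk : G.IsVertexKConnected k) {s : Set V}
    (hs : ∀ x, (¬ Gᶜ.Adj u x ∧ ¬ Gᶜ.Adj v x ∧ ¬ Gᶜ.Adj u' x ∧ ¬ Gᶜ.Adj v' x) → x ∈ s) :
    k ≤ (Gᶜ.neighborSet u').ncard + (Gᶜ.neighborSet v').ncard + s.ncard := by
  refine (hk.le_ncard h.twin h.left).trans ?_
  refine (Set.ncard_le_ncard (t := Gᶜ.neighborSet u' ∪ Gᶜ.neighborSet v' ∪ s) ?_).trans ?_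
  · rintro x ⟨hx, hx'⟩
    have := hs x
    simp only [Set.mem_union, mem_neighborSet]
    tauto
  · exact (Set.ncard_union_le _ _).trans (Nat.add_le_add_right (Set.ncard_union_le _ _) _)

end ComplEdgePair

end SimpleGraph

/-! ### Case analysis on the components of the complement. -/

theorem theorem1p3 {V : Type*} [Fintype V] [DecidableEq V] (G : SimpleGraph V)
    (hconn : G.IsVertexKConnected 4)
    (hclaw : ¬ (completeBipartiteGraph (Fin 1) (Fin 3)).IsIndContained G)
    (hP4 : ¬ (SimpleGraph.pathGraph 4).IsIndContained G) :
    G.HasHamiltonianSquare ∨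
      (∃ m q : ℕ, 1 ≤ m ∧ 1 ≤ q ∧ 4 ≤ m + q ∧
        Nonempty (G ≃g SimpleGraph.joinOfCompletePairs 1 3 m q)) ∨
      (∃ m : ℕ, 3 ≤ m ∧ Nonempty (G ≃g SimpleGraph.joinOfCompletePairs 2 2 1 m)) ∨
      (∃ m : ℕ, 3 ≤ m ∧ Nonempty (G ≃g SimpleGraph.joinOfCompletePairs 2 3 1 m)) ∨
      (∃ m : ℕ, 3 ≤ m ∧ Nonempty (G ≃g SimpleGraph.joinOfCompletePairs 3 3 1 m)) := by
  have hcard : 5 ≤ Fintype.card V := hconn.1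
  have htwin : G.ComplTwin :=
    SimpleGraph.complTwin_of_free (hconn.connected (by norm_num)) hclaw hP4
  by_cases hedge : ∃ u v, Gᶜ.Adj u v
  swap
  · exact Or.inl (SimpleGraph.hasHamiltonianSquare_of_label G hcard (fun _ => 0)
      fun x y hxy hna _ => absurd ⟨x, y, hxy, hna⟩ hedge)
  obtain ⟨u, v, huv⟩ := hedge
  by_cases hedge' : ∃ u' v', Gᶜ.Adj u' v' ∧ ¬ Gᶜ.Adj u u' ∧ ¬ Gᶜ.Adj v u'
  swap
  · refine Or.inl (htwin.hasHamiltonianSquare_of_single hcard huv (fun x y hxy => ?_)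
      (hconn.le_ncard htwin huv))
    by_contra hc
    exact hedge' ⟨x, y, hxy, fun h => hc (Or.inl h), fun h => hc (Or.inr h)⟩
  obtain ⟨u', v', huv', hne, hne'⟩ := hedge'
  have h : G.ComplEdgePair u v u' v' := ⟨htwin, huv, huv', hne, hne'⟩
  by_cases hout : ∃ s, ¬ Gᶜ.Adj u s ∧ ¬ Gᶜ.Adj v s ∧ ¬ Gᶜ.Adj u' s ∧ ¬ Gᶜ.Adj v' s
  · obtain ⟨s, hs⟩ := hout
    refine Or.inl ?_
    by_cases hin : ∃ x y, Gᶜ.Adj x y ∧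
        ¬ Gᶜ.Adj u x ∧ ¬ Gᶜ.Adj v x ∧ ¬ Gᶜ.Adj u' x ∧ ¬ Gᶜ.Adj v' x
    · obtain ⟨x, y, hxy, hx⟩ := hin
      have hy : ¬ Gᶜ.Adj u y ∧ ¬ Gᶜ.Adj v y ∧ ¬ Gᶜ.Adj u' y ∧ ¬ Gᶜ.Adj v' y := by
        have := h.adj_cases hxy
        tauto
      obtain ⟨τ, hτ⟩ := htwin.exists_bipartition
      have hxyτ := hτ x y hxy
      by_cases hxτ : τ x
      · exact h.hasHamiltonianSquare_of_two_outside hcard τ (fun x y hxy _ => hτ x y hxy) hx hy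
          hxτ (hxyτ.1 hxτ)
      · exact h.hasHamiltonianSquare_of_two_outside hcard τ (fun x y hxy _ => hτ x y hxy) hy hx
          (by tauto) hxτ
    by_cases htwo : ∃ t, t ≠ s ∧ ¬ Gᶜ.Adj u t ∧ ¬ Gᶜ.Adj v t ∧ ¬ Gᶜ.Adj u' t ∧ ¬ Gᶜ.Adj v' t
    · obtain ⟨t, hts, ht⟩ := htwo
      -- No edge of `Gᶜ` meets the outside vertices, so any split of them works; `s` is put alone.
      exact h.hasHamiltonianSquare_of_two_outside hcard (· = s)
        (fun x y hxy hx => absurd ⟨x, y, hxy, hx⟩ hin) hs ht rfl hts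
    have hsingle : ∀ x, (¬ Gᶜ.Adj u x ∧ ¬ Gᶜ.Adj v x ∧ ¬ Gᶜ.Adj u' x ∧ ¬ Gᶜ.Adj v' x) →
        x ∈ ({s} : Set V) := by
      intro x hx
      by_contra hxs
      exact htwo ⟨x, hxs, hx⟩
    have h4 := h.le_ncard_add_ncard_add hconn hsingle
    have h4' := h.swap.le_ncard_add_ncard_add hconn
      (fun x hx => hsingle x (by tauto))
    rw [Set.ncard_singleton] at h4 h4'
    -- With `s` the only outside vertex, 4-connectivity gives each component at least three
    -- vertices, hence a side with two.
    have hu : 2 ≤ (Gᶜ.neighborSet u).ncard ∨ 2 ≤ (Gᶜ.neighborSet v).ncard := by omega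
    have hu' : 2 ≤ (Gᶜ.neighborSet u').ncard ∨ 2 ≤ (Gᶜ.neighborSet v').ncard := by omega
    rcases hu with hu | hu <;> rcases hu' with hu' | hu' <;>
      obtain ⟨b, hb, hbv⟩ := Set.exists_ne_of_one_lt_ncard hu _ <;>
      obtain ⟨d, hd, hdv⟩ := Set.exists_ne_of_one_lt_ncard hu' _
    · exact h.hasHamiltonianSquare_of_one_outside hcard
        (fun x y hxy hx => hin ⟨x, y, hxy, hx⟩) hs hb hbv hd hdv
    · exact h.swap_right.hasHamiltonianSquare_of_one_outside hcard
        (fun x y hxy hx => hin ⟨x, y, hxy, by tauto⟩) (by tauto) hb hbv hd hdv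
    · exact h.swap_left.hasHamiltonianSquare_of_one_outside hcard
        (fun x y hxy hx => hin ⟨x, y, hxy, by tauto⟩) (by tauto) hb hbv hd hdv
    · exact h.swap_left.swap_right.hasHamiltonianSquare_of_one_outside hcard
        (fun x y hxy hx => hin ⟨x, y, hxy, by tauto⟩) (by tauto) hb hbv hd hdv
  · have hcover : ∀ x, Gᶜ.Adj u x ∨ Gᶜ.Adj v x ∨ Gᶜ.Adj u' x ∨ Gᶜ.Adj v' x := by
      intro x
      by_contra hx
      exact hout ⟨x, by tauto⟩
    have h4' := h.le_ncard_add_ncard_add hconn (s := ∅) (fun x hx => absurd ⟨x, hx⟩ hout)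
    have h4 := h.swap.le_ncard_add_ncard_add hconn (s := ∅)
      (fun x hx => absurd ⟨x, by tauto⟩ hout)
    rw [Set.ncard_empty, add_zero] at h4 h4'
    have hpos : ∀ {w x}, Gᶜ.Adj w x → 1 ≤ (Gᶜ.neighborSet w).ncard := fun {w x} hx =>
      (Set.ncard_pos).2 ⟨x, hx⟩
    have hu := hpos huv
    have hv := hpos huv.symm
    have hu' := hpos huv'
    have hv' := hpos huv'.symm
    by_cases h1 : (Gᶜ.neighborSet u).ncard = 1
    · exact h.swap.hasHamiltonianSquare_or_iso_of_ncard_eq_one hcard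
        (fun x => by have := hcover x; tauto) h4' h4 h1
    by_cases h2 : (Gᶜ.neighborSet v).ncard = 1
    · exact h.swap.swap_right.hasHamiltonianSquare_or_iso_of_ncard_eq_one hcard
        (fun x => by have := hcover x; tauto) h4' (by omega) h2
    by_cases h3 : (Gᶜ.neighborSet u').ncard = 1
    · exact h.hasHamiltonianSquare_or_iso_of_ncard_eq_one hcard hcover h4 h4' h3
    by_cases h5 : (Gᶜ.neighborSet v').ncard = 1
    · exact h.swap_right.hasHamiltonianSquare_or_iso_of_ncard_eq_one hcard
        (fun x => by have := hcover x; tauto) h4 (by omega) h5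
    obtain ⟨a, ha, hav⟩ := Set.exists_ne_of_one_lt_ncard (s := Gᶜ.neighborSet u) (by omega) v
    obtain ⟨b, hb, hbu⟩ := Set.exists_ne_of_one_lt_ncard (s := Gᶜ.neighborSet v) (by omega) u
    obtain ⟨c, hc, hcv⟩ := Set.exists_ne_of_one_lt_ncard (s := Gᶜ.neighborSet u') (by omega) v'
    obtain ⟨d, hd, hdu⟩ := Set.exists_ne_of_one_lt_ncard (s := Gᶜ.neighborSet v') (by omega) u'
    exact Or.inl (h.hasHamiltonianSquare_of_two_le hcard hcover ha hav hb hbu hc hcv hd hdu)
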